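/- Let $G$ be an amenable, finitely generated, residually finite discrete group, and let $X$ be a locally compact, separable metric space of finite Lebesgue covering dimension $\dim(X)$. Let $G$ act on $X$ by homeomorphisms, and let $\alpha : G\to \mathrm{Aut}(C_0(X))$, $\alpha_g(f)(x)=f(g^{-1}x)$, be the induced action on $C_0(X)$. If the action of $G$ on $X$ is free and proper (that is, the map $G\times X\to X\times X$, $(g,x)\mapsto (gx,x)$ is proper), then $$\dim_{\mathrm{Rok}}(\alpha)\le \dim(X).$$ Here the Rokhlin dimension is defined as follows. For a C*-algebra $A$ let $A_\infty=\ell^\infty(\mathbb N,A)/c_0(\mathbb N,A)$, in which $A$ is embedded as the constant sequences. For a C*-subalgebra $D\subset A$ let $$A_\infty\cap D'=\{x\in A_\infty: xd=dx \text{ for all } d\in D\},\qquad \mathrm{Ann}(D,A_\infty)=\{x\in A_\infty: xd=dx=0\text{ for all } d\in D\},$$ and $F(D,A)=(A_\infty\cap D')/\mathrm{Ann}(D,A_\infty)$, which is unital if $D$ is separable. An action $\alpha:G\to\mathrm{Aut}(A)$ under which $D$ is invariant induces an action $\widetilde\alpha_\infty$ of $G$ on $F(D,A)$. Elements $a,b$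 of a C*-algebra are orthogonal if $ab=ba=a^*b=b^*a=0$, and a contractive completely positive (c.c.p.) map has order zero if it maps orthogonal elements to orthogonal elements. For a subgroup $H\le G$ of finite index, let $G$ act on $C(G/H)$ by $\sigma^H_t(f)(gH)=f(t^{-1}gH)$. Then $\dim_{\mathrm{Rok}}(\alpha,H)$ is the least integer $d$ such that for every separable, $\alpha$-invariant C*-subalgebra $D\subset A$ there are $d+1$ equivariant c.c.p. order zero maps $$\varphi_0,\dots,\varphi_d:(C(G/H),\sigma^H)\to (F(D,A),\widetilde\alpha_\infty)\quad\text{with}\quad \sum_{\ell=0}^d\varphi_\ell(1_{C(G/H)})=1_{F(D,A)},$$ and $+\infty$ if there is no such $d$; and $\dim_{\mathrm{Rok}}(\alpha)=\sup\{\dim_{\mathrm{Rok}}(\alpha,H): H\le G \text{ of finite index}\}$. For $X=\emptyset$, both dimensions are $-1$. -/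

import Mathlib

open Filter Topology
open scoped ENNReal ZeroAtInfty

noncomputable section

namespace CStarRokhlin

/-! ### Quotients of C*-algebras -/

/-- A closed, self-adjoint, two-sided ideal of a C*-algebra. (Closed two-sided ideals are
automatically self-adjoint; recording it as a field avoids having to prove that here.) -/
structure ClosedStarIdeal (B : Type*) [NonUnitalCStarAlgebra B] extends Submodule ℂ B where
  mul_mem_left' : ∀ (b : B) {x : B}, x ∈ carrier → b * x ∈ carrier
  mul_mem_right' : ∀ (b : B) {x : B}, x ∈ carrier → x * b ∈ carrier
  star_mem' : ∀ {x : B}, x ∈ carrier → star x ∈ carrier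
  isClosed' : IsClosed carrier

namespace ClosedStarIdeal

variable {B : Type*} [NonUnitalCStarAlgebra B] (I : ClosedStarIdeal B)

/-- The quotient `B / I`, with the quotient vector space structure and the quotient norm. -/
def Quotient : Type _ := B ⧸ I.toSubmodule

/-- The quotient map `B → B / I`. -/
def proj (b : B) : I.Quotient := Submodule.Quotient.mk (p := I.toSubmodule) b

instance isClosedSubmodule : IsClosed (I.toSubmodule : Set B) := I.isClosed'

instance : NormedAddCommGroup I.Quotient :=
  inferInstanceAs (NormedAddCommGroup (B ⧸ I.toSubmodule))

instance : NormedSpace ℂ I.Quotient :=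
  inferInstanceAs (NormedSpace ℂ (B ⧸ I.toSubmodule))

instance : CompleteSpace I.Quotient :=
  inferInstanceAs (CompleteSpace (B ⧸ I.toSubmodule))

theorem proj_eq_proj {a b : B} : I.proj a = I.proj b ↔ a - b ∈ I.toSubmodule :=
  Submodule.Quotient.eq _

theorem proj_eq_zero {a : B} : I.proj a = 0 ↔ a ∈ I.toSubmodule :=
  Submodule.Quotient.mk_eq_zero _

theorem proj_surjective : Function.Surjective I.proj :=
  Submodule.Quotient.mk_surjective _

theorem proj_add (a b : B) : I.proj (a + b) = I.proj a + I.proj b := rfl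
theorem proj_zero : I.proj 0 = 0 := rfl
theorem proj_smul (c : ℂ) (a : B) : I.proj (c • a) = c • I.proj a := rfl

theorem norm_proj_le (a : B) : ‖I.proj a‖ ≤ ‖a‖ :=
  Submodule.Quotient.norm_mk_le (S := I.toSubmodule) a

theorem exists_proj_norm_lt (x : I.Quotient) {ε : ℝ} (hε : 0 < ε) :
    ∃ a, I.proj a = x ∧ ‖a‖ < ‖x‖ + ε :=
  Submodule.Quotient.norm_mk_lt (S := I.toSubmodule) x hε

instance : Mul I.Quotient where
  mul := Quotient.map₂ (· * ·) fun a a' h b b' h' => by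
    have h : a - a' ∈ I.toSubmodule := (Submodule.quotientRel_def _).1 h
    have h' : b - b' ∈ I.toSubmodule := (Submodule.quotientRel_def _).1 h'
    refine (Submodule.quotientRel_def _).2 ?_
    have : a * b - a' * b' = (a - a') * b + a' * (b - b') := by
      rw [sub_mul, mul_sub]; abel
    rw [this]
    exact add_mem (I.mul_mem_right' _ h) (I.mul_mem_left' _ h')

instance : Star I.Quotient where
  star := Quotient.map star fun a a' h => by
    have h : a - a' ∈ I.toSubmodule := (Submodule.quotientRel_def _).1 h
    refine (Submodule.quotientRel_def _).2 ?_
    rw [← star_sub]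
    exact I.star_mem' h

theorem proj_mul (a b : B) : I.proj (a * b) = I.proj a * I.proj b := rfl
theorem proj_star (a : B) : I.proj (star a) = star (I.proj a) := rfl

theorem norm_mul_le_aux (x y : I.Quotient) : ‖x * y‖ ≤ ‖x‖ * ‖y‖ := by
  have key : ∀ ε : ℝ, 0 < ε → ‖x * y‖ ≤ (‖x‖ + ε) * (‖y‖ + ε) := by
    intro ε hε
    obtain ⟨a, rfl, ha⟩ := I.exists_proj_norm_lt x hε
    obtain ⟨b, rfl, hb⟩ := I.exists_proj_norm_lt y hε
    rw [← proj_mul]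
    refine (I.norm_proj_le _).trans ((norm_mul_le _ _).trans ?_)
    exact mul_le_mul ha.le hb.le (norm_nonneg _) (by positivity)
  have hlim : Tendsto (fun ε : ℝ => (‖x‖ + ε) * (‖y‖ + ε)) (𝓝[>] 0) (𝓝 (‖x‖ * ‖y‖)) := by
    have : Continuous fun ε : ℝ => (‖x‖ + ε) * (‖y‖ + ε) := by fun_prop
    simpa using (this.tendsto 0).mono_left nhdsWithin_le_nhds
  refine ge_of_tendsto hlim ?_
  filter_upwards [self_mem_nhdsWithin] with ε hε using key ε hε

instance : NonUnitalNormedRing I.Quotient :=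
  { (inferInstance : NormedAddCommGroup I.Quotient),
    (inferInstance : Mul I.Quotient) with
    left_distrib := fun x y z => by
      obtain ⟨a, rfl⟩ := I.proj_surjective x
      obtain ⟨b, rfl⟩ := I.proj_surjective y
      obtain ⟨c, rfl⟩ := I.proj_surjective z
      exact congrArg I.proj (mul_add a b c)
    right_distrib := fun x y z => by
      obtain ⟨a, rfl⟩ := I.proj_surjective x
      obtain ⟨b, rfl⟩ := I.proj_surjective y
      obtain ⟨c, rfl⟩ := I.proj_surjective z
      exact congrArg I.proj (add_mul a b c)
    zero_mul := fun x => by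
      obtain ⟨a, rfl⟩ := I.proj_surjective x
      exact congrArg I.proj (zero_mul a)
    mul_zero := fun x => by
      obtain ⟨a, rfl⟩ := I.proj_surjective x
      exact congrArg I.proj (mul_zero a)
    mul_assoc := fun x y z => by
      obtain ⟨a, rfl⟩ := I.proj_surjective x
      obtain ⟨b, rfl⟩ := I.proj_surjective y
      obtain ⟨c, rfl⟩ := I.proj_surjective z
      exact congrArg I.proj (mul_assoc a b c)
    norm_mul_le := I.norm_mul_le_aux }

instance : StarRing I.Quotient where
  star_involutive := fun x => by
    obtain ⟨a, rfl⟩ := I.proj_surjective x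
    exact congrArg I.proj (star_star a)
  star_mul := fun x y => by
    obtain ⟨a, rfl⟩ := I.proj_surjective x
    obtain ⟨b, rfl⟩ := I.proj_surjective y
    exact congrArg I.proj (star_mul a b)
  star_add := fun x y => by
    obtain ⟨a, rfl⟩ := I.proj_surjective x
    obtain ⟨b, rfl⟩ := I.proj_surjective y
    exact congrArg I.proj (star_add a b)

instance : StarModule ℂ I.Quotient where
  star_smul := fun c x => by
    obtain ⟨a, rfl⟩ := I.proj_surjective x
    exact congrArg I.proj (star_smul c a)

instance : IsScalarTower ℂ I.Quotient I.Quotient where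
  smul_assoc := fun c x y => by
    obtain ⟨a, rfl⟩ := I.proj_surjective x
    obtain ⟨b, rfl⟩ := I.proj_surjective y
    exact congrArg I.proj (smul_mul_assoc c a b)

instance : SMulCommClass ℂ I.Quotient I.Quotient where
  smul_comm := fun c x y => by
    obtain ⟨a, rfl⟩ := I.proj_surjective x
    obtain ⟨b, rfl⟩ := I.proj_surjective y
    exact congrArg I.proj (mul_smul_comm c a b).symm

/-- The ideal `I`, as a C*-subalgebra of `B`. -/
def toStarSubalgebra : NonUnitalStarSubalgebra ℂ B where
  carrier := I.carrier
  add_mem' := I.add_mem'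
  zero_mem' := I.zero_mem'
  smul_mem' := I.smul_mem'
  mul_mem' := fun _ hb => I.mul_mem_left' _ hb
  star_mem' := I.star_mem'

instance : IsClosed (I.toStarSubalgebra : Set B) := I.isClosed'

theorem norm_sub_mul_sq_le (a u b : B) (hu : IsSelfAdjoint u) (hu1 : ‖(1 : Unitization ℂ B) - u‖ ≤ 1) :
    ‖a - a * u‖ * ‖a - a * u‖ ≤ ‖star a * a + b‖ + ‖b - b * u‖ := by
  set v : Unitization ℂ B := 1 - (u : Unitization ℂ B) with hv
  have hvs : star v = v := by
    rw [hv, star_sub, star_one, ← Unitization.inr_star, hu.star_eq]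
  have e1 : ((a - a * u : B) : Unitization ℂ B) = a * v := by
    rw [hv, mul_sub, mul_one, Unitization.inr_sub, Unitization.inr_mul]
  have e2 : ((b - b * u : B) : Unitization ℂ B) = b * v := by
    rw [hv, mul_sub, mul_one, Unitization.inr_sub, Unitization.inr_mul]
  rw [← Unitization.norm_inr (𝕜 := ℂ) (a - a * u), ← Unitization.norm_inr (𝕜 := ℂ) (b - b * u),
    ← Unitization.norm_inr (𝕜 := ℂ) (star a * a + b), e1, e2,
    ← CStarRing.norm_star_mul_self]
  have e3 : star ((a : Unitization ℂ B) * v) * (a * v)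
      = v * ((star a * a + b : B) * v - b * v) := by
    rw [star_mul, hvs, Unitization.inr_add, Unitization.inr_mul, Unitization.inr_star, add_mul,
      add_sub_cancel_right]
    simp only [mul_assoc]
  rw [e3]
  calc ‖v * (((star a * a + b : B) : Unitization ℂ B) * v - b * v)‖
      ≤ ‖v‖ * ‖((star a * a + b : B) : Unitization ℂ B) * v - b * v‖ := norm_mul_le _ _
    _ ≤ 1 * (‖((star a * a + b : B) : Unitization ℂ B) * v‖ + ‖(b : Unitization ℂ B) * v‖) := by
        gcongr
        exact norm_sub_le _ _
    _ ≤ ‖((star a * a + b : B) : Unitization ℂ B)‖ + ‖(b : Unitization ℂ B) * v‖ := by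
        rw [one_mul]
        gcongr
        calc _ ≤ ‖((star a * a + b : B) : Unitization ℂ B)‖ * ‖v‖ := norm_mul_le _ _
          _ ≤ ‖((star a * a + b : B) : Unitization ℂ B)‖ * 1 := by gcongr
          _ = _ := mul_one _

theorem norm_one_sub_le {u : I.toStarSubalgebra}
    (hu : ∃ w : I.toStarSubalgebra, u = star w * w) (hu1 : ‖u‖ ≤ 1) :
    ‖(1 : Unitization ℂ B) - ((u : B) : Unitization ℂ B)‖ ≤ 1 := by
  let _ := CStarAlgebra.spectralOrder (Unitization ℂ B)
  have := CStarAlgebra.spectralOrderedRing (Unitization ℂ B)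
  obtain ⟨w, rfl⟩ := hu
  set x : Unitization ℂ B := (((star w * w : I.toStarSubalgebra) : B) : Unitization ℂ B) with hx
  have hx0 : 0 ≤ x := by
    have : x = star (((w : B)) : Unitization ℂ B) * ((w : B) : Unitization ℂ B) := by
      rw [hx, ← Unitization.inr_star, ← Unitization.inr_mul]; rfl
    rw [this]
    exact star_mul_self_nonneg _
  have hx1 : ‖x‖ ≤ 1 := by
    rw [hx, Unitization.norm_inr]; exact hu1
  have hmem : x ∈ Set.Icc 0 1 := CStarAlgebra.mem_Icc_iff_norm_le_one.mpr ⟨hx0, hx1⟩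
  have hmem' : 1 - x ∈ Set.Icc (0 : Unitization ℂ B) 1 := Set.sub_mem_Icc_zero_iff_right.mpr hmem
  exact (CStarAlgebra.mem_Icc_iff_norm_le_one.mp hmem').2

instance : CStarRing I.Quotient where
  norm_mul_self_le := fun x => by
    obtain ⟨a, rfl⟩ := I.proj_surjective x
    refine le_of_forall_pos_le_add fun ε hε => ?_
    obtain ⟨c, hc, hcn⟩ := I.exists_proj_norm_lt (star (I.proj a) * I.proj a) (half_pos hε)
    have hb : c - star a * a ∈ I.toSubmodule :=
      I.proj_eq_proj.1 (by rw [hc, proj_mul, proj_star])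
    set b := c - star a * a with hbdef
    let _ := CStarAlgebra.spectralOrder I.toStarSubalgebra
    have := CStarAlgebra.spectralOrderedRing I.toStarSubalgebra
    have hl := CStarAlgebra.increasingApproximateUnit I.toStarSubalgebra
    have htend := hl.tendsto_mul_left ⟨b, hb⟩
    have hev := (Metric.tendsto_nhds.1 htend) (ε / 2) (half_pos hε)
    obtain ⟨u, hu, hu0, hu1⟩ := (hev.and (hl.eventually_nonneg.and hl.eventually_norm)).exists
    obtain ⟨w, hw⟩ := CStarAlgebra.nonneg_iff_eq_star_mul_self.1 hu0
    have hsa : IsSelfAdjoint (u : B) := by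
      have : IsSelfAdjoint u := IsSelfAdjoint.of_nonneg hu0
      exact congrArg Subtype.val this.star_eq
    have h1 := norm_sub_mul_sq_le a u b hsa (I.norm_one_sub_le ⟨w, hw⟩ hu1)
    have h2 : ‖b - b * u‖ < ε / 2 := by
      rw [dist_comm, dist_eq_norm] at hu
      exact hu
    have h3 : I.proj a = I.proj (a - a * u) := by
      rw [proj_eq_proj, sub_sub_cancel]
      exact I.mul_mem_left' _ u.2
    have h4 : star a * a + b = c := by rw [hbdef]; abel
    have h5 : ‖I.proj a‖ ≤ ‖a - a * u‖ := by rw [h3]; exact I.norm_proj_le _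
    rw [h4] at h1
    have h6 := mul_self_le_mul_self (norm_nonneg _) h5
    linarith

/-- The quotient of a C*-algebra by a closed two-sided ideal is a C*-algebra. -/
instance : NonUnitalCStarAlgebra I.Quotient where

/-- The `*`-homomorphism between quotients induced by a `*`-homomorphism that maps the one ideal
into the other. -/
def map {C : Type*} [NonUnitalCStarAlgebra C] (J : ClosedStarIdeal C) (f : B →⋆ₙₐ[ℂ] C)
    (h : ∀ x ∈ I.toSubmodule, f x ∈ J.toSubmodule) : I.Quotient →⋆ₙₐ[ℂ] J.Quotient where
  toFun := Quotient.map f fun a a' haa' => by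
    have haa' : a - a' ∈ I.toSubmodule := (Submodule.quotientRel_def _).1 haa'
    refine (Submodule.quotientRel_def _).2 ?_
    rw [← map_sub]
    exact h _ haa'
  map_smul' := fun c x => by
    obtain ⟨a, rfl⟩ := I.proj_surjective x
    exact congrArg J.proj (map_smul f c a)
  map_zero' := congrArg J.proj (map_zero f)
  map_add' := fun x y => by
    obtain ⟨a, rfl⟩ := I.proj_surjective x
    obtain ⟨b, rfl⟩ := I.proj_surjective y
    exact congrArg J.proj (map_add f a b)
  map_mul' := fun x y => by
    obtain ⟨a, rfl⟩ := I.proj_surjective x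
    obtain ⟨b, rfl⟩ := I.proj_surjective y
    exact congrArg J.proj (map_mul f a b)
  map_star' := fun x => by
    obtain ⟨a, rfl⟩ := I.proj_surjective x
    exact congrArg J.proj (map_star f a)

theorem map_proj {C : Type*} [NonUnitalCStarAlgebra C] (J : ClosedStarIdeal C) (f : B →⋆ₙₐ[ℂ] C)
    (h : ∀ x ∈ I.toSubmodule, f x ∈ J.toSubmodule) (b : B) :
    I.map J f h (I.proj b) = J.proj (f b) := rfl

end ClosedStarIdeal

/-! ### Sequence algebras and central sequence algebras -/

section SequenceAlgebra

variable (A : Type*) [NonUnitalCStarAlgebra A]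

/-- `ℓ^∞(ℕ, A)`, the C*-algebra of bounded sequences in `A`. -/
abbrev BoundedSeq : Type _ := lp (fun _ : ℕ => A) ∞

/-- `c₀(ℕ, A)`, as an ideal of `ℓ^∞(ℕ, A)`. -/
def nullSeq : ClosedStarIdeal (BoundedSeq A) where
  carrier := {x | Tendsto (fun n => ‖x n‖) atTop (𝓝 0)}
  zero_mem' := by simp
  add_mem' := fun {x y} hx hy =>
    squeeze_zero (fun _ => norm_nonneg _) (fun n => norm_add_le (x n) (y n))
      (by simpa using Tendsto.add hx hy)
  smul_mem' := fun c x hx => by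
    have : Tendsto (fun n => ‖c‖ * ‖x n‖) atTop (𝓝 0) := by
      simpa using Tendsto.const_mul ‖c‖ hx
    simpa [norm_smul] using this
  mul_mem_left' := fun b x hx =>
    squeeze_zero (fun _ => norm_nonneg _)
      (fun n => (norm_mul_le (b n) (x n)).trans
        (mul_le_mul_of_nonneg_right (lp.norm_apply_le_norm ENNReal.top_ne_zero b n)
          (norm_nonneg _)))
      (by simpa using Tendsto.const_mul ‖b‖ hx)
  mul_mem_right' := fun b x hx =>
    squeeze_zero (fun _ => norm_nonneg _)
      (fun n => (norm_mul_le (x n) (b n)).trans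
        (mul_le_mul_of_nonneg_left (lp.norm_apply_le_norm ENNReal.top_ne_zero b n)
          (norm_nonneg _)))
      (by simpa using Tendsto.mul_const ‖b‖ hx)
  star_mem' := fun {x} hx => by simpa using hx
  isClosed' := by
    refine isClosed_of_closure_subset fun x hx => ?_
    rw [Set.mem_ofPred_eq, Metric.tendsto_atTop]
    intro ε hε
    obtain ⟨y, hy, hxy⟩ := Metric.mem_closure_iff.1 hx (ε / 2) (half_pos hε)
    obtain ⟨N, hN⟩ := (Metric.tendsto_atTop.1 hy) (ε / 2) (half_pos hε)
    refine ⟨N, fun n hn => ?_⟩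
    have h1 := hN n hn
    have h2 : ‖x n - y n‖ ≤ ‖x - y‖ := lp.norm_apply_le_norm ENNReal.top_ne_zero (x - y) n
    have h3 : ‖x n‖ ≤ ‖x n - y n‖ + ‖y n‖ := by
      simpa using norm_add_le (x n - y n) (y n)
    rw [dist_eq_norm] at hxy
    simp only [dist_zero_right, norm_norm] at h1 ⊢
    linarith

/-- `A_∞ = ℓ^∞(ℕ, A) / c₀(ℕ, A)`. -/
abbrev SeqAlgebra : Type _ := (nullSeq A).Quotient

variable {A}

/-- The constant sequence with value `a`. -/
def constSeq (a : A) : BoundedSeq A :=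
  ⟨fun _ => a, memℓp_infty ⟨‖a‖, by rintro _ ⟨n, rfl⟩; exact le_rfl⟩⟩

/-- The embedding of `A` into `A_∞` by constant sequences. -/
def constEmb (a : A) : SeqAlgebra A := (nullSeq A).proj (constSeq a)

/-- `A_∞ ∩ D'`, the relative commutant in `A_∞` of (the image of) `D`. As `D` is self-adjoint, the
centralizer of its star-closure is its centralizer. -/
def relCommutant (D : NonUnitalStarSubalgebra ℂ A) : NonUnitalStarSubalgebra ℂ (SeqAlgebra A) :=
  NonUnitalStarSubalgebra.centralizer ℂ (constEmb '' (D : Set A))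

theorem mem_relCommutant {D : NonUnitalStarSubalgebra ℂ A} {x : SeqAlgebra A} :
    x ∈ relCommutant D ↔ ∀ d ∈ D, x * constEmb d = constEmb d * x := by
  rw [relCommutant, NonUnitalStarSubalgebra.mem_centralizer_iff]
  constructor
  · intro h d hd
    exact (h _ ⟨d, hd, rfl⟩).1.symm
  · rintro h _ ⟨d, hd, rfl⟩
    exact ⟨(h d hd).symm, (h (star d) (star_mem hd)).symm⟩

instance (D : NonUnitalStarSubalgebra ℂ A) : IsClosed (relCommutant D : Set (SeqAlgebra A)) := by
  rw [relCommutant, NonUnitalStarSubalgebra.coe_centralizer]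
  exact Set.isClosed_centralizer _

/-- `Ann(D, A_∞) = {x | x d = d x = 0 for all d ∈ D}`, as an ideal of `A_∞ ∩ D'`. -/
def annihilator (D : NonUnitalStarSubalgebra ℂ A) : ClosedStarIdeal (relCommutant D) where
  carrier := {x | ∀ d ∈ D, (x : SeqAlgebra A) * constEmb d = 0 ∧ constEmb d * (x : SeqAlgebra A) = 0}
  zero_mem' := fun d _ => ⟨zero_mul _, mul_zero _⟩
  add_mem' := fun {x y} hx hy d hd => by
    have h1 := hx d hd
    have h2 := hy d hd
    change ((x : SeqAlgebra A) + y) * _ = 0 ∧ _ * ((x : SeqAlgebra A) + y) = 0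
    rw [add_mul, mul_add, h1.1, h1.2, h2.1, h2.2]
    simp
  smul_mem' := fun c x hx d hd => by
    have h1 := hx d hd
    change (c • (x : SeqAlgebra A)) * _ = 0 ∧ _ * (c • (x : SeqAlgebra A)) = 0
    rw [smul_mul_assoc, mul_smul_comm, h1.1, h1.2]
    simp
  mul_mem_left' := fun b x hx d hd => by
    have h1 := hx d hd
    change ((b : SeqAlgebra A) * x) * _ = 0 ∧ _ * ((b : SeqAlgebra A) * x) = 0
    rw [mul_assoc, h1.1, ← mul_assoc, ← mem_relCommutant.1 b.2 d hd, mul_assoc, h1.2]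
    simp
  mul_mem_right' := fun b x hx d hd => by
    have h1 := hx d hd
    change ((x : SeqAlgebra A) * b) * _ = 0 ∧ _ * ((x : SeqAlgebra A) * b) = 0
    rw [mul_assoc, mem_relCommutant.1 b.2 d hd, ← mul_assoc, h1.1, ← mul_assoc, h1.2]
    simp
  star_mem' := fun {x} hx d hd => by
    have h1 := hx (star d) (star_mem hd)
    have hs : constEmb d = star (constEmb (star d)) := by
      conv_lhs => rw [← star_star d]
      rfl
    change star (x : SeqAlgebra A) * _ = 0 ∧ _ * star (x : SeqAlgebra A) = 0
    rw [hs, ← star_mul, ← star_mul, h1.1, h1.2]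
    simp
  isClosed' := by
    have : {x : relCommutant D | ∀ d ∈ D, (x : SeqAlgebra A) * constEmb d = 0 ∧
        constEmb d * (x : SeqAlgebra A) = 0} = ⋂ d ∈ D, ({x : relCommutant D |
        (x : SeqAlgebra A) * constEmb d = 0} ∩ {x | constEmb d * (x : SeqAlgebra A) = 0}) := by
      ext x; simp
    rw [this]
    refine isClosed_biInter fun d _ => IsClosed.inter ?_ ?_
    · exact isClosed_eq (by fun_prop) continuous_const
    · exact isClosed_eq (by fun_prop) continuous_const

/-- The central sequence algebra `F(D, A) = (A_∞ ∩ D') / Ann(D, A_∞)`. -/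
abbrev CentralSeqAlgebra (D : NonUnitalStarSubalgebra ℂ A) : Type _ := (annihilator D).Quotient

/-- The entrywise application of an automorphism to bounded sequences. -/
def seqMap (φ : A ≃⋆ₐ[ℂ] A) : BoundedSeq A →⋆ₙₐ[ℂ] BoundedSeq A where
  toFun x := ⟨fun n => φ (x n), memℓp_infty ⟨‖x‖, by
    rintro _ ⟨n, rfl⟩
    exact (NonUnitalStarAlgHom.norm_apply_le φ (x n)).trans
      (lp.norm_apply_le_norm ENNReal.top_ne_zero x n)⟩⟩
  map_smul' c x := by ext n; exact map_smul φ c (x n)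
  map_zero' := by ext n; exact map_zero φ
  map_add' x y := by ext n; exact map_add φ (x n) (y n)
  map_mul' x y := by ext n; exact map_mul φ (x n) (y n)
  map_star' x := by ext n; exact map_star φ (x n)

/-- The automorphism of `A_∞` induced by an automorphism of `A`. -/
def seqAlgebraMap (φ : A ≃⋆ₐ[ℂ] A) : SeqAlgebra A →⋆ₙₐ[ℂ] SeqAlgebra A :=
  (nullSeq A).map (nullSeq A) (seqMap φ) fun x hx =>
    squeeze_zero (fun _ => norm_nonneg _)
      (fun n => NonUnitalStarAlgHom.norm_apply_le φ (x n)) hx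

theorem seqAlgebraMap_constEmb (φ : A ≃⋆ₐ[ℂ] A) (a : A) :
    seqAlgebraMap φ (constEmb a) = constEmb (φ a) := rfl

variable {G : Type*} [Group G] (α : G →* (A ≃⋆ₐ[ℂ] A))

/-- The `*`-subalgebra `D` is invariant under the action `α`. -/
def IsInvariant (D : NonUnitalStarSubalgebra ℂ A) : Prop := ∀ g : G, ∀ d ∈ D, α g d ∈ D

theorem constEmb_eq_seqAlgebraMap (g : G) (d : A) :
    constEmb d = seqAlgebraMap (α g) (constEmb (α g⁻¹ d)) := by
  rw [seqAlgebraMap_constEmb]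
  congr 1
  have : (α g * α g⁻¹) d = d := by rw [← map_mul, mul_inv_cancel, map_one]; rfl
  exact this.symm

/-- The restriction of `α_∞` to `A_∞ ∩ D'`, for an invariant `D`. -/
def relCommutantMap (D : NonUnitalStarSubalgebra ℂ A) (hD : IsInvariant α D) (g : G) :
    relCommutant D →⋆ₙₐ[ℂ] relCommutant D where
  toFun x := ⟨seqAlgebraMap (α g) x, mem_relCommutant.2 fun d hd => by
    rw [constEmb_eq_seqAlgebraMap α g d, ← map_mul, ← map_mul,
      mem_relCommutant.1 x.2 _ (hD g⁻¹ d hd)]⟩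
  map_smul' c x := Subtype.ext (map_smul (seqAlgebraMap (α g)) c (x : SeqAlgebra A))
  map_zero' := Subtype.ext (map_zero (seqAlgebraMap (α g)))
  map_add' x y := Subtype.ext (map_add (seqAlgebraMap (α g)) (x : SeqAlgebra A) y)
  map_mul' x y := Subtype.ext (map_mul (seqAlgebraMap (α g)) (x : SeqAlgebra A) y)
  map_star' x := Subtype.ext (map_star (seqAlgebraMap (α g)) (x : SeqAlgebra A))

/-- The action of `G` on `F(D, A)` induced by `α`, for an invariant `D`. -/
def centralSeqAction (D : NonUnitalStarSubalgebra ℂ A) (hD : IsInvariant α D) (g : G) :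
    CentralSeqAlgebra D →⋆ₙₐ[ℂ] CentralSeqAlgebra D :=
  (annihilator D).map (annihilator D) (relCommutantMap α D hD g) fun x hx d hd => by
    have h1 := hx (α g⁻¹ d) (hD g⁻¹ d hd)
    change seqAlgebraMap (α g) (x : SeqAlgebra A) * _ = 0 ∧
      _ * seqAlgebraMap (α g) (x : SeqAlgebra A) = 0
    rw [constEmb_eq_seqAlgebraMap α g d, ← map_mul, ← map_mul, h1.1, h1.2]
    simp

end SequenceAlgebra

/-! ### Completely positive contractive maps of order zero -/

section OrderZero

variable {A B : Type*} [NonUnitalCStarAlgebra A] [NonUnitalCStarAlgebra B]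

/-- Orthogonality of elements of a C*-algebra. -/
def IsOrthogonal (a b : A) : Prop := a * b = 0 ∧ b * a = 0 ∧ star a * b = 0 ∧ star b * a = 0

/-- Complete positivity of a linear map, for the usual order of a C*-algebra (in which the
nonnegative elements are the `star x * x`). -/
def IsCompletelyPositive (φ : A →ₗ[ℂ] B) : Prop :=
  letI := CStarAlgebra.spectralOrder A
  haveI := CStarAlgebra.spectralOrderedRing A
  letI := CStarAlgebra.spectralOrder B
  haveI := CStarAlgebra.spectralOrderedRing B
  ∃ ψ : CompletelyPositiveMap A B, ψ.toLinearMap = φ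

/-- Contractive, completely positive (c.c.p.) maps of order zero. -/
structure IsCCPOrderZero (φ : A →ₗ[ℂ] B) : Prop where
  completelyPositive : IsCompletelyPositive φ
  contractive : ∀ a, ‖φ a‖ ≤ ‖a‖
  orderZero : ∀ a b, IsOrthogonal a b → IsOrthogonal (φ a) (φ b)

/-- `e` is the unit of the (possibly non-unital, possibly zero) C*-algebra `B`. -/
def IsUnitElement (e : B) : Prop := ∀ x : B, e * x = x ∧ x * e = x

end OrderZero

/-! ### Rokhlin dimension -/

section Rokhlin

variable {G : Type*} [Group G] [TopologicalSpace G] [DiscreteTopology G]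

/-- The action `σ^H` of `G` on `C(G/H)`, `σ^H_t(f)(gH) = f(t⁻¹gH)`. -/
def cosetTranslation (H : Subgroup G) (t : G) (f : C(G ⧸ H, ℂ)) : C(G ⧸ H, ℂ) :=
  ⟨fun x => f (t⁻¹ • x), by fun_prop⟩

variable {A : Type*} [NonUnitalCStarAlgebra A] (α : G →* (A ≃⋆ₐ[ℂ] A))

/-- For each separable, `α`-invariant C*-subalgebra `D` of `A` there are `k` equivariant c.c.p.
order zero maps `C(G/H) → F(D, A)` whose values at the unit add up to the unit of `F(D, A)`. -/
def HasRokhlinMaps (H : Subgroup G) [H.FiniteIndex] (k : ℕ) : Prop :=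
  ∀ (D : NonUnitalStarSubalgebra ℂ A), IsClosed (D : Set A) →
    TopologicalSpace.IsSeparable (D : Set A) → ∀ hD : IsInvariant α D,
    ∃ φ : Fin k → (C(G ⧸ H, ℂ) →ₗ[ℂ] CentralSeqAlgebra D),
      (∀ l, IsCCPOrderZero (φ l)) ∧
      (∀ l g f, φ l (cosetTranslation H g f) = centralSeqAction α D hD g (φ l f)) ∧
      IsUnitElement (∑ l, φ l 1)

/-- The Rokhlin dimension of `α` relative to `H`: the least integer `d` such that `d + 1` maps as in
`HasRokhlinMaps` exist, and `⊤` if there is none. -/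
def rokhlinDimRel (H : Subgroup G) [H.FiniteIndex] : EReal :=
  ⨅ (k : ℕ) (_ : HasRokhlinMaps α H k), ((k : EReal) - 1)

/-- The Rokhlin dimension of `α`: the supremum of the Rokhlin dimensions relative to the subgroups
of finite index. -/
def rokhlinDim : EReal :=
  ⨆ (H : Subgroup G) (_ : H.FiniteIndex), rokhlinDimRel α H

end Rokhlin

/-! ### Spaces and groups -/

/-- Every open cover of `X` has an open refinement that covers `X` and is such that each point
lies in at most `k` of its members. -/
def HasRefinementsOfMultiplicity (X : Type*) [TopologicalSpace X] (k : ℕ) : Prop :=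
  ∀ 𝒰 : Set (Set X), (∀ U ∈ 𝒰, IsOpen U) → ⋃₀ 𝒰 = Set.univ →
    ∃ 𝒱 : Set (Set X), (∀ V ∈ 𝒱, IsOpen V) ∧ ⋃₀ 𝒱 = Set.univ ∧
      (∀ V ∈ 𝒱, ∃ U ∈ 𝒰, V ⊆ U) ∧ ∀ x : X, {V ∈ 𝒱 | x ∈ V}.encard ≤ k

/-- The Lebesgue covering dimension: the least integer `d` such that every open cover has an open
refinement each point lies in at most `d + 1` members of, and `⊤` if there is none (so that the
empty space has dimension `-1`). -/
def coveringDim (X : Type*) [TopologicalSpace X] : EReal :=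
  ⨅ (k : ℕ) (_ : HasRefinementsOfMultiplicity X k), ((k : EReal) - 1)

/-- Amenability of a discrete group: there is a left-invariant finitely additive probability
measure on the family of all subsets. -/
def IsAmenable (G : Type*) [Group G] : Prop :=
  ∃ μ : Set G → ℝ, (∀ s, 0 ≤ μ s) ∧ μ Set.univ = 1 ∧
    (∀ s t, Disjoint s t → μ (s ∪ t) = μ s + μ t) ∧
    ∀ (g : G) (s : Set G), μ ((fun h => g * h) '' s) = μ s

/-- The homeomorphism `x ↦ g x` of `X`, as a map compatible with the cocompact filter. -/
def smulCocompactMap {G : Type*} (X : Type*) [Group G] [TopologicalSpace X] [MulAction G X]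
    [ContinuousConstSMul G X] (g : G) : CocompactMap X X where
  toFun x := g • x
  continuous_toFun := continuous_const_smul g
  cocompact_tendsto' := (Homeomorph.smul g : X ≃ₜ X).isClosedEmbedding.tendsto_cocompact

/-- The action on `C₀(X)` induced by an action by homeomorphisms on `X`,
`α_g(f)(x) = f(g⁻¹x)`. -/
def inducedAction (G X : Type*) [Group G] [TopologicalSpace X] [MulAction G X]
    [ContinuousConstSMul G X] : G →* (C₀(X, ℂ) ≃⋆ₐ[ℂ] C₀(X, ℂ)) where
  toFun g :=
    { toFun := fun f => f.comp (smulCocompactMap X g⁻¹)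
      invFun := fun f => f.comp (smulCocompactMap X g)
      left_inv := fun f => by
        ext x
        exact congrArg f (inv_smul_smul g x)
      right_inv := fun f => by
        ext x
        exact congrArg f (smul_inv_smul g x)
      map_mul' := fun _ _ => rfl
      map_add' := fun _ _ => rfl
      map_smul' := fun _ _ => rfl
      map_star' := fun _ => rfl }
  map_one' := by
    ext f x
    change f ((1 : G)⁻¹ • x) = f x
    rw [inv_one, one_smul]
  map_mul' g h := by
    ext f x
    change f ((g * h)⁻¹ • x) = f (h⁻¹ • g⁻¹ • x)
    rw [mul_inv_rev, mul_smul]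

theorem inducedAction_apply {G X : Type*} [Group G] [TopologicalSpace X] [MulAction G X]
    [ContinuousConstSMul G X] (g : G) (f : C₀(X, ℂ)) (x : X) :
    inducedAction G X g f x = f (g⁻¹ • x) := rfl

end CStarRokhlin

end

noncomputable section

namespace CStarRokhlin

/-! ### Covers of bounded multiplicity -/

/-! A free proper action of a discrete group makes `p : X → X/G` a principal bundle over a
metrizable space, trivial over the images of small open sets (slices). On a slice `p` is injective
and open, so covering multiplicities pass from `X` to the image of a compact subset. Countably many
such images cover `X/G`, and the countable sum theorem `exists_closed_cover_encard_le` gives a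
closed cover of multiplicity at most `k` inside a given locally finite open cover.

As in a barycentric subdivision, `exists_disjoint_refinements` regroups that cover into `k` families
of disjoint open sets. The union `V l` of a family still trivializes the bundle, so there is an
equivariant, locally constant map `τ l : p⁻¹(V l) → G` (`exists_equivariant_maps`). For a partition
of unity `h l` subordinate to the `V l`, let `a l q` be `√(h l ∘ p)` where `τ l` lies in the coset
`q`, and `0` elsewhere. These functions are equivariant, orthogonal for fixed `l`, and their squares
add up to `1`.

With compactly supported `e n` that are eventually `1` on each compact set, `φ l f` is the class of
`(e n)² ∑ q, f q • (a l q)²`. In the central sequence algebra only the eventual values on compact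
sets count, so the cutoffs spoil neither equivariance nor the sum, which is the unit. Thus every `k`
admissible for `X` is admissible for every `H`. -/

theorem HasRefinementsOfMultiplicity.exists_indexed {X ι : Type*} [TopologicalSpace X] {k : ℕ}
    (h : HasRefinementsOfMultiplicity X k) (U : ι → Set X) (hU : ∀ i, IsOpen (U i))
    (hcov : ⋃ i, U i = Set.univ) :
    ∃ W : ι → Set X, (∀ i, IsOpen (W i)) ∧ ⋃ i, W i = Set.univ ∧ (∀ i, W i ⊆ U i) ∧
      ∀ x, {i | x ∈ W i}.encard ≤ k := by
  obtain ⟨𝒱, hopen, hun, href, hmult⟩ := h (Set.range U) (by rintro _ ⟨i, rfl⟩; exact hU i)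
    (by rw [Set.sUnion_range, hcov])
  have href' : ∀ V : 𝒱, ∃ i, (V : Set X) ⊆ U i := fun V => by
    obtain ⟨_, ⟨i, rfl⟩, hi⟩ := href V V.2
    exact ⟨i, hi⟩
  choose c hc using href'
  -- Members of `𝒱` assigned to the same index are merged, which cannot raise the multiplicity at a
  -- point.
  refine ⟨fun i => ⋃ (V : 𝒱) (_ : c V = i), (V : Set X), fun i => ?_, ?_, fun i => ?_, fun x => ?_⟩
  · exact isOpen_iUnion fun V => isOpen_iUnion fun _ => hopen V V.2
  · refine Set.eq_univ_of_forall fun x => ?_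
    obtain ⟨V, hV, hx⟩ := Set.mem_sUnion.1 (hun ▸ Set.mem_univ x)
    simp only [Set.mem_iUnion]
    exact ⟨c ⟨V, hV⟩, ⟨V, hV⟩, rfl, hx⟩
  · refine Set.iUnion₂_subset fun V hV => ?_
    rw [← hV]
    exact hc V
  · have hsub : {i | x ∈ ⋃ (V : 𝒱) (_ : c V = i), (V : Set X)} ⊆
        c '' {V : 𝒱 | x ∈ (V : Set X)} := by
      intro i hi
      simp only [Set.mem_ofPred_eq, Set.mem_iUnion] at hi
      obtain ⟨V, hV, hx⟩ := hi
      exact ⟨V, hx, hV⟩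
    refine (Set.encard_le_encard hsub).trans ((Set.encard_image_le _ _).trans ?_)
    have himg : Subtype.val '' {V : 𝒱 | x ∈ (V : Set X)} = {V ∈ 𝒱 | x ∈ V} := by
      ext V
      simp [and_comm]
    rw [← Subtype.val_injective.encard_image, himg]
    exact hmult x

/-- The countable sum theorem for covering multiplicity: if any open cover can be refined to one
whose multiplicity is at most `k` on a given one of the sets `F n`, and these cover the space, then
each point-finite open cover contains a closed cover of multiplicity at most `k`. -/
theorem exists_closed_cover_encard_le {Y ι : Type*} [TopologicalSpace Y] [NormalSpace Y] {k : ℕ}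
    (O : ι → Set Y) (hO : ∀ i, IsOpen (O i)) (hcov : ⋃ i, O i = Set.univ)
    (hfin : ∀ y, {i | y ∈ O i}.Finite) (F : ℕ → Set Y) (hF : ⋃ n, F n = Set.univ)
    (href : ∀ n (U : ι → Set Y), (∀ i, IsOpen (U i)) → ⋃ i, U i = Set.univ →
      ∃ W : ι → Set Y, (∀ i, IsOpen (W i)) ∧ ⋃ i, W i = Set.univ ∧ (∀ i, W i ⊆ U i) ∧
        ∀ y ∈ F n, {i | y ∈ W i}.encard ≤ k) :
    ∃ K : ι → Set Y, (∀ i, IsClosed (K i)) ∧ ⋃ i, K i = Set.univ ∧ (∀ i, K i ⊆ O i) ∧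
      ∀ y, {i | y ∈ K i}.encard ≤ k := by
  let T := {U : ι → Set Y // (∀ i, IsOpen (U i)) ∧ ⋃ i, U i = Set.univ ∧ ∀ i, U i ⊆ O i}
  have step : ∀ (n : ℕ) (U : T), ∃ W : T, (∀ i, closure (W.1 i) ⊆ U.1 i) ∧
      ∀ y ∈ F n, {i | y ∈ W.1 i}.encard ≤ k := by
    rintro n ⟨U, hUo, hUc, hUO⟩
    obtain ⟨W, hWo, hWc, hWU, hWk⟩ := href n U hUo hUc
    obtain ⟨W', hW'c, hW'o, hW'⟩ := exists_iUnion_eq_closure_subset hWo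
      (fun y => (hfin y).subset fun i hi => hUO i (hWU i hi)) hWc
    refine ⟨⟨W', hW'o, hW'c, fun i => ?_⟩, fun i => (hW' i).trans (hWU i), fun y hy => ?_⟩
    · exact subset_closure.trans ((hW' i).trans ((hWU i).trans (hUO i)))
    · exact (Set.encard_le_encard fun i hi => hW' i (subset_closure hi)).trans (hWk y hy)
  choose next hnext hnextk using step
  -- Each cover contains the closures of the next one, and cover `n + 1` has multiplicity at most
  -- `k` on `F n`. The intersections are therefore closed and inherit all these bounds.
  let U : ℕ → T := fun n => Nat.rec ⟨O, hO, hcov, fun _ => subset_rfl⟩ next n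
  have hU : ∀ n i, closure ((U (n + 1)).1 i) ⊆ (U n).1 i := fun n => hnext n (U n)
  have hanti : ∀ i, Antitone fun n => (U n).1 i := fun i =>
    antitone_nat_of_succ_le fun n => subset_closure.trans (hU n i)
  have hK : ∀ i, ⋂ n, (U n).1 i = ⋂ n, closure ((U (n + 1)).1 i) := fun i =>
    Set.Subset.antisymm
      (Set.subset_iInter fun n => (Set.iInter_subset _ (n + 1)).trans subset_closure)
      (Set.iInter_mono fun n => hU n i)
  refine ⟨fun i => ⋂ n, (U n).1 i, fun i => ?_, ?_, fun i => Set.iInter_subset (fun n => (U n).1 i) 0,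
    fun y => ?_⟩
  · change IsClosed (⋂ n, (U n).1 i)
    rw [hK]
    exact isClosed_iInter fun n => isClosed_closure
  · refine Set.eq_univ_of_forall fun y => ?_
    -- Point-finiteness is what keeps the intersections a cover: the index sets at `y` are finite,
    -- nonempty and decreasing.
    have hne : (⋂ n, {i | y ∈ (U n).1 i}).Nonempty := by
      have h0 : ∀ n, {i | y ∈ (U n).1 i}.Finite := fun n => (hfin y).subset fun i hi => (U n).2.2.2 i hi
      let : TopologicalSpace ι := ⊥
      have : DiscreteTopology ι := ⟨rfl⟩
      refine IsCompact.nonempty_iInter_of_sequence_nonempty_isCompact_isClosed _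
        (fun n i hi => hanti i n.le_succ hi) (fun n => ?_) (h0 0).isCompact
        fun n => isClosed_discrete _
      obtain ⟨i, hi⟩ := Set.mem_iUnion.1 ((U n).2.2.1 ▸ Set.mem_univ y)
      exact ⟨i, hi⟩
    obtain ⟨i, hi⟩ := hne
    exact Set.mem_iUnion.2 ⟨i, by simpa using hi⟩
  · obtain ⟨n, hn⟩ := Set.mem_iUnion.1 (hF ▸ Set.mem_univ y)
    refine (Set.encard_le_encard fun i hi => ?_).trans (hnextk n (U n) y hn)
    exact Set.mem_iInter.1 hi (n + 1)

/-- A Urysohn function vanishing off `O` is multiplied by a function of the distance to `K` that is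
`1` exactly on `K`. The exact level set gives the strict inequalities needed in
`exists_disjoint_refinements`. -/
theorem exists_continuous_eq_one_iff_mem {Y : Type*} [TopologicalSpace Y]
    [TopologicalSpace.MetrizableSpace Y] {K O : Set Y} (hK : IsClosed K) (hO : IsOpen O)
    (hKO : K ⊆ O) :
    ∃ f : Y → ℝ, Continuous f ∧ (∀ y, 0 ≤ f y ∧ f y ≤ 1) ∧ (∀ y, f y = 1 ↔ y ∈ K) ∧
      ∀ y, y ∉ O → f y = 0 := by
  let := TopologicalSpace.metrizableSpaceMetric Y
  -- `Metric.infDist` to the empty set is `0`, so the formula below would fail for it.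
  rcases K.eq_empty_or_nonempty with rfl | hne
  · exact ⟨fun _ => 0, continuous_const, by simp, by simp, by simp⟩
  obtain ⟨u, hu0, hu1, hu⟩ := exists_continuous_zero_one_of_isClosed hO.isClosed_compl hK
    (Set.disjoint_left.2 fun y hy hy' => hy (hKO hy'))
  refine ⟨fun y => u y * max 0 (1 - Metric.infDist y K), ?_, fun y => ?_, fun y => ?_, fun y hy => ?_⟩
  · have := Metric.continuous_infDist_pt K
    fun_prop
  · have h := hu y
    have hd := Metric.infDist_nonneg (x := y) (s := K)
    exact ⟨mul_nonneg h.1 (le_max_left _ _),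
      mul_le_one₀ h.2 (le_max_left _ _) (max_le zero_le_one (by linarith))⟩
  · rw [hK.mem_iff_infDist_zero hne]
    have h := hu y
    have hd := Metric.infDist_nonneg (x := y) (s := K)
    constructor
    · intro hy
      by_contra hne'
      have hpos := lt_of_le_of_ne hd (Ne.symm hne')
      have : max 0 (1 - Metric.infDist y K) < 1 := max_lt zero_lt_one (by linarith)
      have := mul_le_of_le_one_left (le_max_left 0 (1 - Metric.infDist y K)) h.2
      linarith
    · intro hy
      have : u y = 1 := hu1 ((hK.mem_iff_infDist_zero hne).2 hy)
      simp [this, hy]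
  · have : u y = 0 := hu0 hy
    simp [this]

/-- A locally finite open cover that contains a closed cover of multiplicity at most `k` is refined
by open sets indexed by finite sets, those indexed by sets of equal size being disjoint, such that
the ones indexed by nonempty sets of size at most `k` cover the space. -/
theorem exists_disjoint_refinements {Y ι : Type*} [TopologicalSpace Y]
    [TopologicalSpace.MetrizableSpace Y] {k : ℕ} (O : ι → Set Y) (hO : ∀ i, IsOpen (O i))
    (hlf : LocallyFinite O) (K : ι → Set Y) (hK : ∀ i, IsClosed (K i)) (hcov : ⋃ i, K i = Set.univ)
    (hKO : ∀ i, K i ⊆ O i) (hmult : ∀ y, {i | y ∈ K i}.encard ≤ k) :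
    ∃ V : Finset ι → Set Y, (∀ S, IsOpen (V S)) ∧
      (∀ S S', S.card = S'.card → ∀ y, y ∈ V S → y ∈ V S' → S = S') ∧
      (∀ S, ∀ i ∈ S, V S ⊆ O i) ∧ ∀ y, ∃ S, S.Nonempty ∧ S.card ≤ k ∧ y ∈ V S := by
  choose f hf hf01 hf1 hf0 using fun i => exists_continuous_eq_one_iff_mem (hK i) (hO i) (hKO i)
  -- `V S` is where the functions indexed by `S` are positive and dominate all others. Distinct sets
  -- of equal size each contain an index outside the other, which would give `f j y < f i y < f j
  -- y`.
  refine ⟨fun S => {y | ∀ i ∈ S, 0 < f i y ∧ ∀ j, j ∉ S → f j y < f i y}, fun S => ?_, ?_, ?_,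
    fun y => ?_⟩
  · have : {y | ∀ i ∈ S, 0 < f i y ∧ ∀ j, j ∉ S → f j y < f i y} =
        ⋂ i ∈ S, {y | 0 < f i y ∧ ∀ j, j ∉ S → f j y < f i y} := by
      ext y; simp
    change IsOpen {y | ∀ i ∈ S, 0 < f i y ∧ ∀ j, j ∉ S → f j y < f i y}
    rw [this]
    refine isOpen_biInter_finset fun i _ => isOpen_iff_mem_nhds.2 fun y hy => ?_
    -- Near `y` all but finitely many `f j` vanish, so only finitely many comparisons need
    -- continuity.
    obtain ⟨N, hN, hNf⟩ := hlf y
    have h1 : ∀ᶠ z in 𝓝 y, ∀ j ∈ {j | (O j ∩ N).Nonempty}, j ∉ S → f j z < f i z := by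
      refine (hNf.eventually_all).2 fun j _ => ?_
      by_cases hj : j ∈ S
      · simp [hj]
      · filter_upwards [(hf j).continuousAt.eventually_lt (hf i).continuousAt (hy.2 j hj)] with z hz _
        exact hz
    have h2 : ∀ᶠ z in 𝓝 y, 0 < f i z := continuousAt_const.eventually_lt (hf i).continuousAt hy.1
    filter_upwards [h1, h2, hN] with z hz1 hz2 hzN
    refine ⟨hz2, fun j hj => ?_⟩
    by_cases hzj : z ∈ O j
    · exact hz1 j ⟨z, hzj, hzN⟩ hj
    · rw [hf0 j z hzj]
      exact hz2
  · intro S S' hcard y hy hy'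
    by_contra hne
    obtain ⟨i, hi, hi'⟩ := Finset.not_subset.1 fun hsub => hne (Finset.eq_of_subset_of_card_le hsub hcard.ge)
    obtain ⟨j, hj, hj'⟩ := Finset.not_subset.1 fun hsub =>
      hne (Finset.eq_of_subset_of_card_le hsub hcard.le).symm
    exact lt_asymm ((hy i hi).2 j hj') ((hy' j hj).2 i hi')
  · intro S i hi y hy
    by_contra hyO
    exact (hy i hi).1.ne' (hf0 i y hyO)
  -- Take for `S` the indices with `y ∈ K i`: there `f i y = 1`, and all other values are below `1`.
  · have hfin : {i | y ∈ K i}.Finite := Set.finite_of_encard_le_coe (hmult y)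
    refine ⟨hfin.toFinset, ?_, ?_, fun i hi => ?_⟩
    · obtain ⟨i, hi⟩ := Set.mem_iUnion.1 (hcov ▸ Set.mem_univ y)
      exact ⟨i, by simpa using hi⟩
    · have := hmult y
      rwa [hfin.encard_eq_coe_toFinset_card, Nat.cast_le] at this
    · have hi1 : f i y = 1 := (hf1 i y).2 (by simpa using hi)
      refine ⟨by simp [hi1], fun j hj => ?_⟩
      rw [hi1]
      refine lt_of_le_of_ne (hf01 j y).2 fun h => hj ?_
      simpa using (hf1 j y).1 h

/-! ### Free and proper actions of discrete groups -/

section FreeProper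

variable {G : Type*} [Group G] [TopologicalSpace G] {X : Type*} [TopologicalSpace X]
  [MulAction G X] [ProperSMul G X]

/-- Any open cover of the orbit space can be refined to one whose multiplicity is at most `k` on
the image of a compact set that is contained in a slice. -/
theorem exists_orbitSpace_refinement {k : ℕ} (hk : HasRefinementsOfMultiplicity X k)
    {C U : Set X} (hC : IsCompact C) (hU : IsOpen U) (hCU : C ⊆ U)
    (hslice : ∀ (g : G) (u : X), u ∈ U → g • u ∈ U → g = 1) {ι : Type*}
    (W : ι → Set (Quotient (MulAction.orbitRel G X))) (hW : ∀ i, IsOpen (W i))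
    (hcov : ⋃ i, W i = Set.univ) :
    ∃ W' : ι → Set (Quotient (MulAction.orbitRel G X)), (∀ i, IsOpen (W' i)) ∧
      ⋃ i, W' i = Set.univ ∧ (∀ i, W' i ⊆ W i) ∧
      ∀ y ∈ Quotient.mk (MulAction.orbitRel G X) '' C, {i | y ∈ W' i}.encard ≤ k := by
  have hq : IsOpenQuotientMap (Quotient.mk (MulAction.orbitRel G X)) :=
    MulAction.isOpenQuotientMap_quotientMk
  set p := Quotient.mk (MulAction.orbitRel G X)
  obtain ⟨T, hTo, hTc, hTW, hTk⟩ := hk.exists_indexed (fun i => p ⁻¹' W i)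
    (fun i => (hW i).preimage hq.continuous)
    (by rw [← Set.preimage_iUnion, hcov, Set.preimage_univ])
  -- The cover is changed only over `p '' C`, which is closed since the orbit space is Hausdorff. As
  -- `p` is injective on `U`, the indices at `p c` are among those with `c ∈ T i`.
  refine ⟨fun i => W i ∩ ((p '' C)ᶜ ∪ p '' (T i ∩ U)), fun i => ?_, ?_,
    fun i => Set.inter_subset_left, ?_⟩
  · exact (hW i).inter ((hC.image hq.continuous).isClosed.isOpen_compl.union
      (hq.isOpenMap _ ((hTo i).inter hU)))
  · refine Set.eq_univ_of_forall fun y => Set.mem_iUnion.2 ?_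
    by_cases hy : y ∈ p '' C
    · obtain ⟨c, hc, rfl⟩ := hy
      obtain ⟨i, hi⟩ := Set.mem_iUnion.1 (hTc ▸ Set.mem_univ c)
      exact ⟨i, hTW i hi, Or.inr ⟨c, ⟨hi, hCU hc⟩, rfl⟩⟩
    · obtain ⟨i, hi⟩ := Set.mem_iUnion.1 (hcov ▸ Set.mem_univ y)
      exact ⟨i, hi, Or.inl hy⟩
  · rintro _ ⟨c, hc, rfl⟩
    refine (Set.encard_le_encard ?_).trans (hTk c)
    rintro i ⟨-, hi | ⟨w, ⟨hwT, hwU⟩, hw⟩⟩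
    · exact absurd ⟨c, hc, rfl⟩ hi
    · obtain ⟨g, rfl⟩ := MulAction.orbitRel_apply.1 (Quotient.exact hw)
      have hg : g = 1 := hslice g c (hCU hc) hwU
      simpa [hg] using hwT

variable [LocallyCompactSpace X]

variable (G X) in
-- Properness makes the quotient Hausdorff; local compactness and second countability descend along
-- the open quotient map, and Urysohn's metrization theorem applies.
theorem metrizableSpace_orbitSpace [SecondCountableTopology X] :
    TopologicalSpace.MetrizableSpace (Quotient (MulAction.orbitRel G X)) := by
  have hq : IsOpenQuotientMap (Quotient.mk (MulAction.orbitRel G X)) :=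
    MulAction.isOpenQuotientMap_quotientMk
  have := hq.locallyCompactSpace
  have := TopologicalSpace.Quotient.secondCountableTopology (S := MulAction.orbitRel G X)
    hq.isOpenMap
  infer_instance

variable [DiscreteTopology G] [T2Space X]

/-- For discrete `G` properness is proper discontinuity: a small neighbourhood of `x` meets only its
translates by the stabilizer, which is trivial. -/
theorem exists_isOpen_smul_mem_imp_eq_one (hfree : ∀ (g : G) (x : X), g • x = x → g = 1) (x : X) :
    ∃ U : Set X, IsOpen U ∧ x ∈ U ∧ ∀ (g : G) (u : X), u ∈ U → g • u ∈ U → g = 1 := by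
  have : ProperlyDiscontinuousSMul G X := properlyDiscontinuousSMul_iff_properSMul.2 inferInstance
  obtain ⟨U, hU, h⟩ := ProperlyDiscontinuousSMul.exists_nhds_image_smul_eq_self G x
  refine ⟨interior U, isOpen_interior, mem_interior_iff_mem_nhds.2 hU, fun g u hu hgu => ?_⟩
  exact hfree g x (h g ⟨g • u, ⟨u, interior_subset hu, rfl⟩, interior_subset hgu⟩)

/-- The orbit space is covered by `k` open sets over which there are equivariant continuous maps
to `G`. -/
theorem exists_equivariant_maps [SecondCountableTopology X]
    (hfree : ∀ (g : G) (x : X), g • x = x → g = 1) {k : ℕ}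
    (hk : HasRefinementsOfMultiplicity X k) :
    ∃ (V : Fin k → Set (Quotient (MulAction.orbitRel G X))) (τ : Fin k → X → G),
      (∀ l, IsOpen (V l)) ∧ ⋃ l, V l = Set.univ ∧
      (∀ l x, Quotient.mk _ x ∈ V l → ∀ g : G, τ l (g • x) = g * τ l x) ∧
      ∀ l x, Quotient.mk _ x ∈ V l → ∀ᶠ x' in 𝓝 x, τ l x' = τ l x := by
  have := metrizableSpace_orbitSpace G X
  have hq : IsOpenQuotientMap (Quotient.mk (MulAction.orbitRel G X)) :=
    MulAction.isOpenQuotientMap_quotientMk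
  set p := Quotient.mk (MulAction.orbitRel G X) with hp
  have hpg : ∀ (g : G) (x : X), p (g • x) = p x := fun g x => Quotient.sound ⟨g, rfl⟩
  have : ParacompactSpace (Quotient (MulAction.orbitRel G X)) := by
    let := TopologicalSpace.metrizableSpaceMetric (Quotient (MulAction.orbitRel G X))
    infer_instance
  rcases isEmpty_or_nonempty X with hX | ⟨⟨x₀⟩⟩
  · refine ⟨fun _ => ∅, fun _ _ => 1, fun _ => isOpen_empty, Set.eq_univ_of_forall fun y => ?_,
      fun _ x => isEmptyElim x, fun _ x => isEmptyElim x⟩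
    obtain ⟨x, -⟩ := hq.surjective y
    exact isEmptyElim x
  choose U hUo hxU hUs using exists_isOpen_smul_mem_imp_eq_one (X := X) hfree
  obtain ⟨O, hOo, hOc, hOlf, hOU⟩ := precise_refinement (fun x => p '' U x)
    (fun x => hq.isOpenMap _ (hUo x)) (Set.eq_univ_of_forall fun y => by
      obtain ⟨x, rfl⟩ := hq.surjective y
      exact Set.mem_iUnion.2 ⟨x, x, hxU x, rfl⟩)
  have hFex : ∃ F : ℕ → Set (Quotient (MulAction.orbitRel G X)), ⋃ n, F n = Set.univ ∧
      ∀ n, ∃ C x, IsCompact C ∧ C ⊆ U x ∧ F n = p '' C := by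
    choose C hCn hCU hCc using fun x => local_compact_nhds ((hUo x).mem_nhds (hxU x))
    obtain ⟨s, hs, hsc⟩ := TopologicalSpace.countable_cover_nhds hCn
    have hsne : s.Nonempty := by
      by_contra h
      rw [Set.not_nonempty_iff_eq_empty] at h
      subst h
      have hx₀ := Set.mem_univ x₀
      rw [← hsc] at hx₀
      simp at hx₀
    obtain ⟨u, rfl⟩ := hs.exists_eq_range hsne
    refine ⟨fun n => p '' C (u n), Set.eq_univ_of_forall fun y => ?_,
      fun n => ⟨C (u n), u n, hCc _, hCU _, rfl⟩⟩
    obtain ⟨x, rfl⟩ := hq.surjective y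
    have hx := hsc ▸ Set.mem_univ x
    simp only [Set.biUnion_range, Set.mem_iUnion] at hx ⊢
    obtain ⟨n, hn⟩ := hx
    exact ⟨n, x, hn, rfl⟩
  obtain ⟨F, hF, hFC⟩ := hFex
  obtain ⟨K, hKc, hKcov, hKO, hKk⟩ := exists_closed_cover_encard_le (k := k) O hOo hOc
    hOlf.point_finite F hF fun n W hWo hWc => by
      obtain ⟨C, x, hC, hCU, hFn⟩ := hFC n
      rw [hFn]
      exact exists_orbitSpace_refinement hk hC (hUo x) hCU (hUs x) W hWo hWc
  obtain ⟨V, hVo, hVd, hVO, hVc⟩ := exists_disjoint_refinements O hOo hOlf K hKc hKcov hKO hKk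
  -- `g` translates the slice belonging to `S` onto one containing `x`. The centre `hS.choose`
  -- depends on `S` alone, so it is constant along orbits and on `p⁻¹(V S)`. Sizes `l + 1` with `l <
  -- k` are those of the nonempty sets of size at most `k`; this leaves out `V ∅`, which is the
  -- whole space.
  let R : ℕ → X → G → Prop := fun l x g => ∃ (S : Finset X) (hS : S.Nonempty),
    S.card = l + 1 ∧ p x ∈ V S ∧ g⁻¹ • x ∈ U hS.choose
  have hRu : ∀ l x g g', R l x g → R l x g' → g = g' := by
    rintro l x g g' ⟨S, hS, hSl, hSV, hSU⟩ ⟨S', hS', hSl', hSV', hSU'⟩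
    obtain rfl := hVd S S' (hSl.trans hSl'.symm) _ hSV hSV'
    have h1 := hUs _ (g'⁻¹ * g) _ hSU (by rw [mul_smul, smul_inv_smul]; exact hSU')
    exact (inv_mul_eq_one.1 h1).symm
  have hRg : ∀ l x g h, R l x g → R l (h • x) (h * g) := by
    rintro l x g h ⟨S, hS, hSl, hSV, hSU⟩
    refine ⟨S, hS, hSl, by rwa [hpg], ?_⟩
    rwa [mul_inv_rev, mul_smul, inv_smul_smul]
  have hRo : ∀ l x g, R l x g → ∀ᶠ x' in 𝓝 x, R l x' g := by
    rintro l x g ⟨S, hS, hSl, hSV, hSU⟩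
    filter_upwards [((hVo S).preimage hq.continuous).mem_nhds hSV,
      ((hUo _).preimage (continuous_const_smul g⁻¹)).mem_nhds hSU] with x' h1 h2
    exact ⟨S, hS, hSl, h1, h2⟩
  have hRe : ∀ (l : ℕ) (x : X), p x ∈ ⋃ (S : Finset X) (_ : S.card = l + 1), V S →
      ∃ g, R l x g := by
    intro l x hx
    simp only [Set.mem_iUnion] at hx
    obtain ⟨S, hSl, hSV⟩ := hx
    have hS : S.Nonempty := Finset.card_pos.1 (by omega)
    obtain ⟨u, hu, hux⟩ := hOU _ (hVO S _ hS.choose_spec hSV)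
    obtain ⟨g, rfl⟩ := MulAction.orbitRel_apply.1 (Quotient.exact hux)
    refine ⟨g⁻¹, S, hS, hSl, hSV, ?_⟩
    rwa [inv_inv]
  classical
  let τ : ℕ → X → G := fun l x => if h : ∃ g, R l x g then h.choose else 1
  have hτ : ∀ l x g, R l x g → τ l x = g := by
    intro l x g h
    have hex : ∃ g, R l x g := ⟨g, h⟩
    simp only [τ, dif_pos hex]
    exact hRu l x _ _ hex.choose_spec h
  refine ⟨fun l => ⋃ (S : Finset X) (_ : S.card = (l : ℕ) + 1), V S, fun l => τ l, fun l => ?_, ?_,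
    fun l x hx g => ?_, fun l x hx => ?_⟩
  · exact isOpen_iUnion fun S => isOpen_iUnion fun _ => hVo S
  · refine Set.eq_univ_of_forall fun y => ?_
    obtain ⟨S, hS, hSk, hSV⟩ := hVc y
    have hpos := hS.card_pos
    simp only [Set.mem_iUnion]
    exact ⟨⟨S.card - 1, by omega⟩, S, by simp only; omega, hSV⟩
  · obtain ⟨g', hg'⟩ := hRe l x hx
    change τ l (g • x) = g * τ l x
    rw [hτ _ _ _ hg', hτ _ _ _ (hRg _ _ _ g hg')]
  · obtain ⟨g', hg'⟩ := hRe l x hx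
    filter_upwards [hRo _ _ _ hg'] with x' hx'
    rw [hτ _ _ _ hg', hτ _ _ _ hx']

theorem exists_equivariant_functions [SecondCountableTopology X]
    (hfree : ∀ (g : G) (x : X), g • x = x → g = 1) {k : ℕ}
    (hk : HasRefinementsOfMultiplicity X k) (H : Subgroup G) [Fintype (G ⧸ H)] :
    ∃ a : Fin k → G ⧸ H → C(X, ℝ), (∀ l q q' x, q ≠ q' → a l q x * a l q' x = 0) ∧
      (∀ l q (g : G) x, a l (g • q) (g • x) = a l q x) ∧
      ∀ x, ∑ l, ∑ q, a l q x * a l q x = 1 := by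
  classical
  obtain ⟨V, τ, hVo, hVc, hτg, hτc⟩ := exists_equivariant_maps hfree hk
  have := metrizableSpace_orbitSpace G X
  have hq : IsOpenQuotientMap (Quotient.mk (MulAction.orbitRel G X)) :=
    MulAction.isOpenQuotientMap_quotientMk
  set p := Quotient.mk (MulAction.orbitRel G X) with hp
  have hpg : ∀ (g : G) (x : X), p (g • x) = p x := fun g x => Quotient.sound ⟨g, rfl⟩
  obtain ⟨h, hh⟩ := PartitionOfUnity.exists_isSubordinate_of_locallyFinite isClosed_univ V hVo
    (locallyFinite_of_finite _) hVc.ge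
  have hzero : ∀ l x, p x ∉ V l → h l (p x) = 0 := fun l x hx =>
    image_eq_zero_of_notMem_tsupport fun hx' => hx (hh l hx')
  -- The square root is taken so that the Rokhlin maps have coefficients of the form `star c * c`.
  refine ⟨fun l q => ⟨fun x => if (τ l x : G ⧸ H) = q then √(h l (p x)) else 0, ?_⟩, ?_, ?_, ?_⟩
  · refine continuous_iff_continuousAt.2 fun x => ?_
    -- Over `V l` the coset of `τ l` is locally constant; elsewhere `h l ∘ p` vanishes near `x`,
    -- because its support lies over `V l`.
    by_cases hx : p x ∈ V l
    · have hev : (fun x' => if (τ l x : G ⧸ H) = q then √(h l (p x')) else 0) =ᶠ[𝓝 x]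
          fun x' => if (τ l x' : G ⧸ H) = q then √(h l (p x')) else 0 := by
        filter_upwards [hτc l x hx] with x' hx'
        rw [hx']
      refine ContinuousAt.congr ?_ hev
      split_ifs
      · exact ((h l).continuous.comp hq.continuous).sqrt.continuousAt
      · exact continuousAt_const
    · have hev : (fun _ => (0 : ℝ)) =ᶠ[𝓝 x]
          fun x' => if (τ l x' : G ⧸ H) = q then √(h l (p x')) else 0 := by
        filter_upwards [((isClosed_tsupport _).isOpen_compl.preimage hq.continuous).mem_nhds
          (show x ∈ p ⁻¹' (tsupport (h l))ᶜ from fun hx' => hx (hh l hx'))] with x' hx'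
        rw [image_eq_zero_of_notMem_tsupport hx']
        simp
      exact continuousAt_const.congr hev
  · intro l q q' x hqq'
    simp only [ContinuousMap.coe_mk]
    split_ifs with h1 h2 <;> simp
    exact absurd (h1.symm.trans h2) hqq'
  · intro l q g x
    simp only [ContinuousMap.coe_mk, hpg]
    by_cases hx : p x ∈ V l
    · have : ((g * τ l x : G) : G ⧸ H) = g • (τ l x : G ⧸ H) := rfl
      simp only [hτg l x hx g, this, smul_left_cancel_iff]
    · simp [hzero l x hx]
  · intro x
    have : ∀ l, ∑ q : G ⧸ H, (if (τ l x : G ⧸ H) = q then √(h l (p x)) else 0) *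
        (if (τ l x : G ⧸ H) = q then √(h l (p x)) else 0) = h l (p x) := by
      intro l
      rw [Finset.sum_eq_single (τ l x : G ⧸ H) (fun q _ hq' => by rw [if_neg hq'.symm, zero_mul])
        (fun hn => absurd (Finset.mem_univ _) hn), if_pos rfl, Real.mul_self_sqrt (h.nonneg l _)]
    simp only [ContinuousMap.coe_mk, this]
    rw [← finsum_eq_sum_of_fintype]
    exact h.sum_eq_one (Set.mem_univ _)

end FreeProper

/-! ### Order zero maps on functions on a finite space -/

theorem exists_eq_star_mul_self_of_nonneg {A : Type*} [NonUnitalCStarAlgebra A] [PartialOrder A]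
    [StarOrderedRing A] {a : A} (ha : 0 ≤ a) : ∃ b, a = star b * b :=
  CStarAlgebra.nonneg_iff_eq_star_mul_self.1 ha

/-- Multiplicativity of the characters sends a positive matrix `star N * N` to `∑ t, star (R t) * R
t`, where `R t` has the entries `χ t (N m j) • c t`. -/
theorem isCompletelyPositive_of_eq_sum {T A B : Type*} [Fintype T] [NonUnitalCStarAlgebra A]
    [NonUnitalCStarAlgebra B] (χ : T → A →⋆ₙₐ[ℂ] ℂ) (c : T → B) {φ : A →ₗ[ℂ] B}
    (hφ : ∀ a, φ a = ∑ t, χ t a • (star (c t) * c t)) : IsCompletelyPositive φ := by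
  let _ := CStarAlgebra.spectralOrder A
  have := CStarAlgebra.spectralOrderedRing A
  let _ := CStarAlgebra.spectralOrder B
  have := CStarAlgebra.spectralOrderedRing B
  refine ⟨⟨φ, fun k M hM => ?_⟩, rfl⟩
  obtain ⟨N, rfl⟩ := exists_eq_star_mul_self_of_nonneg hM
  let R : T → CStarMatrix (Fin k) (Fin k) B := fun t =>
    CStarMatrix.ofMatrix fun m j => χ t (N m j) • c t
  have key : (star N * N).map φ = ∑ t, star (R t) * R t := by
    ext i j
    have hsum : ∀ (s : Finset T) (S : T → CStarMatrix (Fin k) (Fin k) B),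
        (∑ t ∈ s, S t) i j = ∑ t ∈ s, S t i j := fun s S => by
      classical
      induction s using Finset.induction_on with
      | empty => rfl
      | insert a s ha ih => rw [Finset.sum_insert ha, Finset.sum_insert ha, CStarMatrix.add_apply, ih]
    rw [hsum, CStarMatrix.map_apply, hφ]
    refine Finset.sum_congr rfl fun t _ => ?_
    rw [CStarMatrix.mul_apply, CStarMatrix.mul_apply, map_sum, Finset.sum_smul]
    refine Finset.sum_congr rfl fun m _ => ?_
    change χ t (star (N m i) * N m j) • (star (c t) * c t)
      = star (χ t (N m i) • c t) * (χ t (N m j) • c t)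
    rw [star_smul, smul_mul_smul_comm, map_mul, map_star]
  change 0 ≤ (star N * N).map φ
  rw [key]
  exact Finset.sum_nonneg fun t _ => star_mul_self_nonneg _

section SumEval

variable {T : Type*} [TopologicalSpace T] [Fintype T] {B : Type*} [NonUnitalCStarAlgebra B]

/-- The linear map `f ↦ ∑ t, f t • b t`. -/
def sumEval (b : T → B) : C(T, ℂ) →ₗ[ℂ] B where
  toFun f := ∑ t, f t • b t
  map_add' f g := by simp [add_smul, Finset.sum_add_distrib]
  map_smul' c f := by simp [mul_smul, Finset.smul_sum]

theorem sumEval_apply (b : T → B) (f : C(T, ℂ)) : sumEval b f = ∑ t, f t • b t := rfl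

theorem star_sumEval {b : T → B} (hb : ∀ t, star (b t) = b t) (f : C(T, ℂ)) :
    star (sumEval b f) = sumEval b (star f) := by
  simp [sumEval_apply, hb]

theorem sumEval_mul_sumEval_eq_zero {b : T → B} (hb : ∀ t t', t ≠ t' → b t * b t' = 0)
    {f g : C(T, ℂ)} (hfg : f * g = 0) : sumEval b f * sumEval b g = 0 := by
  rw [sumEval_apply, sumEval_apply, Finset.sum_mul_sum]
  refine Finset.sum_eq_zero fun t _ => Finset.sum_eq_zero fun t' _ => ?_
  rw [smul_mul_smul_comm]
  by_cases h : t = t'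
  · subst h
    have : f t * g t = 0 := DFunLike.congr_fun hfg t
    rw [this, zero_smul]
  · rw [hb t t' h, smul_zero]

theorem isCompletelyPositive_sumEval (c : T → B) :
    IsCompletelyPositive (sumEval fun t => star (c t) * c t) :=
  isCompletelyPositive_of_eq_sum (fun t => (ContinuousMap.evalStarAlgHom ℂ ℂ t : C(T, ℂ) →⋆ₙₐ[ℂ] ℂ))
    c fun _ => rfl

/-- The coefficients are self-adjoint and mutually orthogonal, so products of values reduce to the
diagonal terms `f t * g t`. Contractivity is left as a hypothesis, to be checked pointwise on
sequences of functions. -/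
theorem isCCPOrderZero_sumEval (c : T → B)
    (hc : ∀ t t', t ≠ t' → star (c t) * c t * (star (c t') * c t') = 0)
    (hnorm : ∀ f, ‖sumEval (fun t => star (c t) * c t) f‖ ≤ ‖f‖) :
    IsCCPOrderZero (sumEval fun t => star (c t) * c t) where
  completelyPositive := isCompletelyPositive_sumEval c
  contractive := hnorm
  orderZero f g h := by
    have hs : ∀ t, star (star (c t) * c t) = star (c t) * c t := fun t => by simp
    refine ⟨?_, ?_, ?_, ?_⟩
    · exact sumEval_mul_sumEval_eq_zero hc h.1
    · exact sumEval_mul_sumEval_eq_zero hc h.2.1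
    · rw [star_sumEval hs]
      exact sumEval_mul_sumEval_eq_zero hc h.2.2.1
    · rw [star_sumEval hs]
      exact sumEval_mul_sumEval_eq_zero hc h.2.2.2

end SumEval

/-! ### Central sequences in commutative algebras -/

section Commutative

variable {A : Type*} [NonUnitalCStarAlgebra A]

theorem proj_mem_relCommutant (hcomm : ∀ a b : A, a * b = b * a) (D : NonUnitalStarSubalgebra ℂ A)
    (x : BoundedSeq A) : (nullSeq A).proj x ∈ relCommutant D :=
  mem_relCommutant.2 fun d _ => by
    rw [constEmb, ← ClosedStarIdeal.proj_mul, ← ClosedStarIdeal.proj_mul]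
    congr 1
    ext n
    exact hcomm _ _

/-- For a commutative C*-algebra `A`, the quotient map `ℓ^∞(ℕ, A) → F(D, A)`. -/
def toCentralSeq (hcomm : ∀ a b : A, a * b = b * a) (D : NonUnitalStarSubalgebra ℂ A) :
    BoundedSeq A →⋆ₙₐ[ℂ] CentralSeqAlgebra D where
  toFun x := (annihilator D).proj ⟨(nullSeq A).proj x, proj_mem_relCommutant hcomm D x⟩
  map_smul' _ _ := rfl
  map_zero' := rfl
  map_add' _ _ := rfl
  map_mul' _ _ := rfl
  map_star' _ := rfl

theorem toCentralSeq_surjective (hcomm : ∀ a b : A, a * b = b * a)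
    (D : NonUnitalStarSubalgebra ℂ A) : Function.Surjective (toCentralSeq hcomm D) := fun y => by
  obtain ⟨⟨z, hz⟩, rfl⟩ := (annihilator D).proj_surjective y
  obtain ⟨x, rfl⟩ := (nullSeq A).proj_surjective z
  exact ⟨x, rfl⟩

/-- Such a class annihilates `D` from the right, hence by commutativity from both sides. -/
theorem toCentralSeq_eq_zero (hcomm : ∀ a b : A, a * b = b * a) {D : NonUnitalStarSubalgebra ℂ A}
    {x : BoundedSeq A} (hx : ∀ d ∈ D, Tendsto (fun n => ‖x n * d‖) atTop (𝓝 0)) :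
    toCentralSeq hcomm D x = 0 := by
  refine (annihilator D).proj_eq_zero.2 fun d hd => ?_
  have h : (nullSeq A).proj x * constEmb d = 0 := (nullSeq A).proj_eq_zero.2 (hx d hd)
  exact ⟨h, (mem_relCommutant.1 (proj_mem_relCommutant hcomm D x) d hd).symm.trans h⟩

theorem centralSeqAction_toCentralSeq {G : Type*} [Group G] (α : G →* (A ≃⋆ₐ[ℂ] A))
    (hcomm : ∀ a b : A, a * b = b * a) {D : NonUnitalStarSubalgebra ℂ A} (hD : IsInvariant α D)
    (g : G) (x : BoundedSeq A) :
    centralSeqAction α D hD g (toCentralSeq hcomm D x) = toCentralSeq hcomm D (seqMap (α g) x) :=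
  rfl

end Commutative

/-! ### Cutoffs and sequences of functions vanishing at infinity -/

section ZeroAtInfty

variable {X : Type*} [TopologicalSpace X]

theorem norm_zeroAtInfty_le {f : C₀(X, ℂ)} {C : ℝ} (hC : 0 ≤ C) (h : ∀ x, ‖f x‖ ≤ C) : ‖f‖ ≤ C := by
  rw [← ZeroAtInftyContinuousMap.norm_toBCF_eq_norm]
  exact (BoundedContinuousFunction.norm_le hC).2 h

theorem norm_zeroAtInfty_apply_le (f : C₀(X, ℂ)) (x : X) : ‖f x‖ ≤ ‖f‖ := by
  rw [← ZeroAtInftyContinuousMap.norm_toBCF_eq_norm]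
  exact f.toBCF.norm_coe_le_norm x

/-- Two bounded sequences of functions that eventually agree on each compact set define the same
element of the central sequence algebra. -/
theorem toCentralSeq_congr {D : NonUnitalStarSubalgebra ℂ C₀(X, ℂ)} {x y : BoundedSeq C₀(X, ℂ)}
    (h : ∀ K : Set X, IsCompact K → ∀ᶠ n in atTop, ∀ p ∈ K, x n p = y n p) :
    toCentralSeq mul_comm D x = toCentralSeq mul_comm D y := by
  rw [← sub_eq_zero, ← map_sub]
  refine toCentralSeq_eq_zero _ fun d _ => ?_
  rw [Metric.tendsto_atTop]
  intro ε hε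
  set M := ‖x - y‖ with hM
  have hM0 : 0 ≤ M := norm_nonneg _
  -- Off a compact set `d` is this small while the difference is at most `M`; `M + 1` avoids
  -- division by zero.
  have hδ : 0 < ε / 2 / (M + 1) := by positivity
  have hd : ∀ᶠ p in cocompact X, ‖d p‖ < ε / 2 / (M + 1) := by
    filter_upwards [(zero_at_infty d).eventually (Metric.ball_mem_nhds 0 hδ)] with p hp
    simpa using hp
  obtain ⟨K, hK, hKd⟩ := mem_cocompact.1 hd
  obtain ⟨N, hN⟩ := eventually_atTop.1 (h K hK)
  refine ⟨N, fun n hn => ?_⟩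
  have hle : ‖(x - y) n * d‖ ≤ ε / 2 := by
    refine norm_zeroAtInfty_le (by positivity) fun p => ?_
    rw [ZeroAtInftyContinuousMap.mul_apply, norm_mul]
    by_cases hp : p ∈ K
    · have : (x - y) n p = 0 := by
        change x n p - y n p = 0
        rw [hN n hn p hp, sub_self]
      rw [this]
      simpa using (half_pos hε).le
    · have h1 : ‖(x - y) n p‖ ≤ M := (norm_zeroAtInfty_apply_le _ p).trans
        (lp.norm_apply_le_norm ENNReal.top_ne_zero (x - y) n)
      have h2 : ‖d p‖ < ε / 2 / (M + 1) := hKd hp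
      calc ‖(x - y) n p‖ * ‖d p‖ ≤ (M + 1) * (ε / 2 / (M + 1)) :=
            mul_le_mul (by linarith) h2.le (norm_nonneg _) (by positivity)
        _ = ε / 2 := by field_simp
  rw [dist_zero_right, norm_norm]
  linarith

/-- Urysohn functions equal to `1` on the terms of a compact exhaustion. They bring continuous
functions into `C₀(X)` without changing their eventual values on compact sets. -/
theorem exists_compactly_supported_approximate_unit (X : Type*) [TopologicalSpace X]
    [LocallyCompactSpace X] [SigmaCompactSpace X] [T2Space X] :
    ∃ e : ℕ → C(X, ℝ), (∀ n, HasCompactSupport (e n)) ∧ (∀ n x, 0 ≤ e n x ∧ e n x ≤ 1) ∧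
      ∀ K : Set X, IsCompact K → ∀ᶠ n in atTop, ∀ x ∈ K, e n x = 1 := by
  let C := CompactExhaustion.choice X
  choose e he _ hec he01 using fun n => exists_continuous_one_zero_of_isCompact (C.isCompact n)
    isClosed_empty (Set.disjoint_empty _)
  refine ⟨e, hec, fun n x => he01 n x, fun K hK => ?_⟩
  obtain ⟨N, hN⟩ := C.exists_superset_of_isCompact hK
  filter_upwards [eventually_ge_atTop N] with n hn x hx
  exact he n (C.subset hn (hN hx))

/-- The product of a compactly supported function and a continuous function, as an element of
`C₀(X)`. -/
def cutoff (e b : C(X, ℝ)) (he : HasCompactSupport e) : C₀(X, ℂ) where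
  toFun x := ((e x * b x : ℝ) : ℂ)
  continuous_toFun := by fun_prop
  zero_at_infty' := by
    have : HasCompactSupport fun x => ((e x * b x : ℝ) : ℂ) :=
      (he.mul_right (f' := b)).comp_left (g := ((↑) : ℝ → ℂ)) Complex.ofReal_zero
    exact this.is_zero_at_infty

theorem cutoff_apply (e b : C(X, ℝ)) (he : HasCompactSupport e) (x : X) :
    cutoff e b he x = ((e x * b x : ℝ) : ℂ) := rfl

theorem norm_cutoff_le {e b : C(X, ℝ)} (he : HasCompactSupport e) (he01 : ∀ x, 0 ≤ e x ∧ e x ≤ 1)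
    (hb : ∀ x, |b x| ≤ 1) : ‖cutoff e b he‖ ≤ 1 := by
  refine norm_zeroAtInfty_le zero_le_one fun x => ?_
  rw [cutoff_apply, Complex.norm_real, norm_mul, Real.norm_eq_abs, Real.norm_eq_abs,
    abs_of_nonneg (he01 x).1]
  exact mul_le_one₀ (he01 x).2 (abs_nonneg _) (hb x)

/-- The bounded sequence of the functions `e n * b`. -/
def cutoffSeq (e : ℕ → C(X, ℝ)) (b : C(X, ℝ)) (he : ∀ n, HasCompactSupport (e n))
    (he01 : ∀ n x, 0 ≤ e n x ∧ e n x ≤ 1) (hb : ∀ x, |b x| ≤ 1) : BoundedSeq C₀(X, ℂ) :=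
  ⟨fun n => cutoff (e n) b (he n), memℓp_infty ⟨1, by
    rintro _ ⟨n, rfl⟩
    exact norm_cutoff_le (he n) (he01 n) hb⟩⟩

theorem star_mul_cutoffSeq_apply (e : ℕ → C(X, ℝ)) (b : C(X, ℝ))
    (he : ∀ n, HasCompactSupport (e n)) (he01 : ∀ n x, 0 ≤ e n x ∧ e n x ≤ 1)
    (hb : ∀ x, |b x| ≤ 1) (n : ℕ) (x : X) :
    (star (cutoffSeq e b he he01 hb) * cutoffSeq e b he he01 hb) n x
      = ((e n x * e n x * (b x * b x) : ℝ) : ℂ) := by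
  change star ((e n x * b x : ℝ) : ℂ) * ((e n x * b x : ℝ) : ℂ) = _
  rw [Complex.star_def, Complex.conj_ofReal, ← Complex.ofReal_mul]
  congr 1
  ring

theorem boundedSeq_sum_apply {ι : Type*} (s : Finset ι) (y : ι → BoundedSeq C₀(X, ℂ)) (n : ℕ)
    (x : X) : (∑ i ∈ s, y i) n x = ∑ i ∈ s, y i n x := by
  classical
  induction s using Finset.induction_on with
  | empty => rfl
  | insert a s ha ih =>
    rw [Finset.sum_insert ha, Finset.sum_insert ha, ← ih]
    rfl

end ZeroAtInfty

/-! ### The Rokhlin maps of a free and proper action -/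

theorem hasRokhlinMaps_inducedAction {G : Type*} [Group G] [TopologicalSpace G]
    [DiscreteTopology G] {X : Type*} [TopologicalSpace X] [LocallyCompactSpace X] [T2Space X]
    [SecondCountableTopology X] [MulAction G X] [ProperSMul G X]
    (hfree : ∀ (g : G) (x : X), g • x = x → g = 1) {k : ℕ}
    (hk : HasRefinementsOfMultiplicity X k) (H : Subgroup G) [H.FiniteIndex] :
    HasRokhlinMaps (inducedAction G X) H k := by
  intro D _ _ hD
  let _ : Fintype (G ⧸ H) := H.fintypeQuotientOfFiniteIndex
  obtain ⟨a, haorth, haequiv, hasum⟩ := exists_equivariant_functions hfree hk H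
  obtain ⟨e, hec, he01, heK⟩ := exists_compactly_supported_approximate_unit X
  have hsq : ∀ l q x, a l q x * a l q x ≤ 1 := fun l q x => by
    rw [← hasum x]
    refine (Finset.single_le_sum (f := fun q => a l q x * a l q x)
      (fun q _ => mul_self_nonneg _) (Finset.mem_univ q)).trans ?_
    exact Finset.single_le_sum (f := fun l => ∑ q, a l q x * a l q x)
      (fun l _ => Finset.sum_nonneg fun q _ => mul_self_nonneg _) (Finset.mem_univ l)
  have ha1 : ∀ l q x, |a l q x| ≤ 1 := fun l q x => by
    rw [← sq_le_one_iff_abs_le_one, sq]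
    exact hsq l q x
  let Q := toCentralSeq mul_comm D
  let C : Fin k → G ⧸ H → BoundedSeq C₀(X, ℂ) := fun l q =>
    cutoffSeq e (a l q) hec he01 (ha1 l q)
  let P : Fin k → G ⧸ H → BoundedSeq C₀(X, ℂ) := fun l q => star (C l q) * C l q
  have hP : ∀ l q n x, P l q n x = ((e n x * e n x * (a l q x * a l q x) : ℝ) : ℂ) :=
    fun l q n x => star_mul_cutoffSeq_apply e (a l q) hec he01 (ha1 l q) n x
  have hQP : ∀ l q, star (Q (C l q)) * Q (C l q) = Q (P l q) := fun l q => by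
    rw [← map_star, ← map_mul]
  have hφ : ∀ l f, sumEval (fun q => star (Q (C l q)) * Q (C l q)) f = Q (∑ q, f q • P l q) := by
    intro l f
    simp only [sumEval_apply, hQP, map_sum, map_smul]
  refine ⟨fun l => sumEval fun q => star (Q (C l q)) * Q (C l q), fun l => ?_, fun l g f => ?_, ?_⟩
  · refine isCCPOrderZero_sumEval _ (fun q q' hqq' => ?_) fun f => ?_
    · rw [hQP, hQP, ← map_mul]
      have : P l q * P l q' = 0 := by
        ext n x
        change P l q n x * P l q' n x = 0
        rw [hP, hP, ← Complex.ofReal_mul, Complex.ofReal_eq_zero]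
        linear_combination (e n x * e n x * (a l q x * a l q' x) * (e n x * e n x)) *
          haorth l q q' x hqq'
      rw [this, map_zero]
    · rw [hφ]
      -- `Q` is contractive, so it suffices to bound the representing functions, using `(e n)² ≤ 1`
      -- and `∑ q, (a l q)² ≤ 1`.
      refine (NonUnitalStarAlgHom.norm_apply_le Q _).trans ?_
      refine lp.norm_le_of_forall_le (norm_nonneg f) fun n =>
        norm_zeroAtInfty_le (norm_nonneg f) fun x => ?_
      rw [boundedSeq_sum_apply]
      calc ‖∑ q, (f q • P l q) n x‖ ≤ ∑ q, ‖f‖ * (a l q x * a l q x) := by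
            refine norm_sum_le_of_le _ fun q _ => ?_
            change ‖f q * P l q n x‖ ≤ _
            rw [hP, norm_mul, Complex.norm_real, Real.norm_eq_abs,
              abs_of_nonneg (mul_nonneg (mul_self_nonneg _) (mul_self_nonneg _))]
            have h1 : e n x * e n x ≤ 1 := mul_le_one₀ (he01 n x).2 (he01 n x).1 (he01 n x).2
            exact mul_le_mul (f.norm_coe_le_norm q)
              (mul_le_of_le_one_left (mul_self_nonneg _) h1)
              (mul_nonneg (mul_self_nonneg _) (mul_self_nonneg _)) (norm_nonneg _)
        _ = ‖f‖ * ∑ q, a l q x * a l q x := by rw [Finset.mul_sum]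
        _ ≤ ‖f‖ * 1 := by
            refine mul_le_mul_of_nonneg_left ?_ (norm_nonneg _)
            rw [← hasum x]
            exact Finset.single_le_sum (f := fun l => ∑ q, a l q x * a l q x)
              (fun l _ => Finset.sum_nonneg fun q _ => mul_self_nonneg _) (Finset.mem_univ l)
        _ = ‖f‖ := mul_one _
  -- The cutoffs are not invariant, but eventually they are `1` on both `K` and `g⁻¹ • K`.
  · have hact : ∀ q, Q (seqMap (inducedAction G X g) (P l q)) = Q (P l (g • q)) := by
      intro q
      refine toCentralSeq_congr fun K hK => ?_
      filter_upwards [heK K hK, heK _ (hK.image (continuous_const_smul g⁻¹))] with n h1 h2 x hx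
      change P l q n (g⁻¹ • x) = P l (g • q) n x
      rw [hP, hP, h1 x hx, h2 _ ⟨x, hx, rfl⟩, ← haequiv l q g (g⁻¹ • x), smul_inv_smul]
    rw [hφ, hφ, centralSeqAction_toCentralSeq, map_sum, map_sum, map_sum]
    simp only [map_smul]
    rw [← Equiv.sum_comp (MulAction.toPerm g)]
    refine Finset.sum_congr rfl fun q _ => ?_
    have : cosetTranslation H g f (g • q) = f q := congrArg f (inv_smul_smul g q)
    rw [MulAction.toPerm_apply, this]
    exact congrArg (f q • ·) (hact q).symm
  · have hsum : ∑ l, sumEval (fun q => star (Q (C l q)) * Q (C l q)) 1 = Q (∑ l, ∑ q, P l q) := by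
      simp only [hφ, ContinuousMap.one_apply, one_smul, ← map_sum]
    -- The squares of the `a l q` add up to `1`, so only `(e n)²` remains, and its class acts as the
    -- unit.
    have hE : ∀ n x, (∑ l, ∑ q, P l q) n x = ((e n x * e n x : ℝ) : ℂ) := by
      intro n x
      simp only [boundedSeq_sum_apply, hP]
      rw [← mul_one ((e n x * e n x : ℝ) : ℂ), ← Complex.ofReal_one, ← hasum x]
      push_cast
      simp only [Finset.mul_sum]
    rw [hsum]
    intro y
    obtain ⟨Y, rfl⟩ := toCentralSeq_surjective mul_comm D y
    have hunit : Q (∑ l, ∑ q, P l q) * toCentralSeq mul_comm D Y = toCentralSeq mul_comm D Y := by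
      rw [← map_mul]
      refine toCentralSeq_congr fun K hK => ?_
      filter_upwards [heK K hK] with n hn x hx
      change (∑ l, ∑ q, P l q) n x * Y n x = Y n x
      rw [hE, hn x hx]
      simp
    refine ⟨hunit, Eq.trans ?_ hunit⟩
    rw [← map_mul, ← map_mul]
    congr 1
    ext n x
    exact mul_comm _ _

end CStarRokhlin

end

theorem mainTheorem9 {G : Type*} [Group G] [TopologicalSpace G] [DiscreteTopology G]
    (hamen : CStarRokhlin.IsAmenable G) [Group.FG G] [Group.ResiduallyFinite G]
    {X : Type*} [MetricSpace X] [LocallyCompactSpace X] [TopologicalSpace.SeparableSpace X]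
    (hdim : CStarRokhlin.coveringDim X < ⊤)
    [MulAction G X] [ProperSMul G X] (hfree : ∀ (g : G) (x : X), g • x = x → g = 1) :
    CStarRokhlin.rokhlinDim (CStarRokhlin.inducedAction G X) ≤ CStarRokhlin.coveringDim X := by
  have := UniformSpace.secondCountable_of_separable X
  -- Both dimensions are infima of `k - 1`, with the same shift, so it suffices to compare
  -- admissible `k`; `k = 0` covers the empty space.
  exact le_iInf₂ fun k hk => iSup₂_le fun H _ =>
    iInf₂_le k (CStarRokhlin.hasRokhlinMaps_inducedAction hfree hk H)
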